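/- Let $N$ be a (not necessarily unital) C*-algebra and let $A \subset N$ be a separable C*-subalgebra. Then there exists a separable C*-subalgebra $B$ with $A \subset B \subset N$ such that the maps $K_0(B) \to K_0(N)$ and $K_1(B) \to K_1(N)$ induced by the inclusion are injective, and such that $K_0(B) \to K_0(N)$ is an order isomorphism of $K_0(B)$ onto its image, a subgroup of $K_0(N)$ with the restricted order: for all $x, y \in K_0(B)$ with images $x', y' \in K_0(N)$, one has $x \le y$ if and only if $x' \le y'$. Here, for a C*-algebra $D$, the relation $x \le y$ on $K_0(D)$ means that $y - x$ is the class of a projection in some matrix algebra $M_n(D)$ (in general this is only a preorder). -/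

import Mathlib

open scoped Matrix

noncomputable section

namespace CStarKTheory

/-! ### Murray–von Neumann equivalence of projections in matrix algebras -/

section MurrayVonNeumann

variable {D : Type*} [NonUnitalRing D] [StarRing D]
variable {ι κ μ ν : Type*} [Fintype ι] [Fintype κ] [Fintype μ] [Fintype ν]

/-- Murray–von Neumann equivalence of square matrices `p`, `q`, possibly of different sizes:
`p = v* v` and `q = v v*` for some rectangular matrix `v` over `D`. -/
def MvN (p : Matrix ι ι D) (q : Matrix κ κ D) : Prop :=
  ∃ v : Matrix κ ι D, vᴴ * v = p ∧ v * vᴴ = q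

/-- The block diagonal sum `p ⊕ q`. -/
def dsum {m n : ℕ} (p : Matrix (Fin m) (Fin m) D) (q : Matrix (Fin n) (Fin n) D) :
    Matrix (Fin (m + n)) (Fin (m + n)) D :=
  (Matrix.fromBlocks p 0 0 q).submatrix finSumFinEquiv.symm finSumFinEquiv.symm

lemma isStarProjection_conjTranspose {p : Matrix ι ι D} (hp : IsStarProjection p) : pᴴ = p :=
  hp.isSelfAdjoint

lemma isStarProjection_mul_self {p : Matrix ι ι D} (hp : IsStarProjection p) : p * p = p :=
  hp.isIdempotentElem

lemma MvN.refl {p : Matrix ι ι D} (hp : IsStarProjection p) : MvN p p :=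
  ⟨p, by rw [isStarProjection_conjTranspose hp, isStarProjection_mul_self hp],
    by rw [isStarProjection_conjTranspose hp, isStarProjection_mul_self hp]⟩

lemma MvN.symm {p : Matrix ι ι D} {q : Matrix κ κ D} (h : MvN p q) : MvN q p := by
  obtain ⟨v, h1, h2⟩ := h
  exact ⟨vᴴ, by rw [Matrix.conjTranspose_conjTranspose, h2],
    by rw [Matrix.conjTranspose_conjTranspose, h1]⟩

lemma MvN.trans {p : Matrix ι ι D} {q : Matrix κ κ D} {r : Matrix μ μ D}
    (hp : IsStarProjection p) (hr : IsStarProjection r) (h : MvN p q) (h' : MvN q r) :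
    MvN p r := by
  obtain ⟨v, h1, h2⟩ := h
  obtain ⟨w, h3, h4⟩ := h'
  refine ⟨w * v, ?_, ?_⟩
  · calc (w * v)ᴴ * (w * v) = vᴴ * (wᴴ * w) * v := by
          rw [Matrix.conjTranspose_mul]; simp only [Matrix.mul_assoc]
      _ = (vᴴ * v) * (vᴴ * v) := by rw [h3, ← h2]; simp only [Matrix.mul_assoc]
      _ = p := by rw [h1, isStarProjection_mul_self hp]
  · calc (w * v) * (w * v)ᴴ = w * (v * vᴴ) * wᴴ := by
          rw [Matrix.conjTranspose_mul]; simp only [Matrix.mul_assoc]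
      _ = (w * wᴴ) * (w * wᴴ) := by rw [h2, ← h3]; simp only [Matrix.mul_assoc]
      _ = r := by rw [h4, isStarProjection_mul_self hr]

lemma MvN.submatrix {p : Matrix ι ι D} (hp : IsStarProjection p) (e : κ ≃ ι) :
    MvN p (p.submatrix e e) := by
  refine ⟨p.submatrix e id, ?_, ?_⟩
  · rw [Matrix.conjTranspose_submatrix, Matrix.submatrix_mul_equiv,
      isStarProjection_conjTranspose hp, isStarProjection_mul_self hp, Matrix.submatrix_id_id]
  · have := Matrix.submatrix_mul_equiv p p e (Equiv.refl ι) e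
    rw [Matrix.conjTranspose_submatrix, isStarProjection_conjTranspose hp]
    rw [isStarProjection_mul_self hp] at this
    exact this

lemma isStarProjection_submatrix {p : Matrix ι ι D} (hp : IsStarProjection p) (e : κ ≃ ι) :
    IsStarProjection (p.submatrix e e) where
  isIdempotentElem := by
    rw [IsIdempotentElem, Matrix.submatrix_mul_equiv, isStarProjection_mul_self hp]
  isSelfAdjoint := by
    rw [IsSelfAdjoint, Matrix.star_eq_conjTranspose, Matrix.conjTranspose_submatrix,
      isStarProjection_conjTranspose hp]

lemma isStarProjection_fromBlocks {p : Matrix ι ι D} {q : Matrix κ κ D}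
    (hp : IsStarProjection p) (hq : IsStarProjection q) :
    IsStarProjection (Matrix.fromBlocks p 0 0 q) where
  isIdempotentElem := by
    rw [IsIdempotentElem, Matrix.fromBlocks_multiply]
    simp [isStarProjection_mul_self hp, isStarProjection_mul_self hq]
  isSelfAdjoint := by
    rw [IsSelfAdjoint, Matrix.star_eq_conjTranspose, Matrix.fromBlocks_conjTranspose]
    simp [isStarProjection_conjTranspose hp, isStarProjection_conjTranspose hq]

lemma isStarProjection_dsum {m n : ℕ} {p : Matrix (Fin m) (Fin m) D}
    {q : Matrix (Fin n) (Fin n) D} (hp : IsStarProjection p) (hq : IsStarProjection q) :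
    IsStarProjection (dsum p q) :=
  isStarProjection_submatrix (isStarProjection_fromBlocks hp hq) _

lemma MvN.fromBlocks {p : Matrix ι ι D} {q : Matrix κ κ D} {p' : Matrix μ μ D}
    {q' : Matrix ν ν D} (h : MvN p p') (h' : MvN q q') :
    MvN (Matrix.fromBlocks p 0 0 q) (Matrix.fromBlocks p' 0 0 q') := by
  obtain ⟨v, h1, h2⟩ := h
  obtain ⟨w, h3, h4⟩ := h'
  refine ⟨Matrix.fromBlocks v 0 0 w, ?_, ?_⟩ <;>
  · rw [Matrix.fromBlocks_conjTranspose, Matrix.fromBlocks_multiply]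
    simp [h1, h2, h3, h4]

lemma MvN.dsum_fromBlocks {m n : ℕ} {p : Matrix (Fin m) (Fin m) D}
    {q : Matrix (Fin n) (Fin n) D} (hp : IsStarProjection p) (hq : IsStarProjection q) :
    MvN (dsum p q) (Matrix.fromBlocks p 0 0 q) :=
  (MvN.submatrix (isStarProjection_fromBlocks hp hq) _).symm

end MurrayVonNeumann

/-! ### The semigroup `V(D)` and its Grothendieck group -/

section Semigroup

variable (D : Type*) [NonUnitalRing D] [StarRing D]

/-- The projections in all the matrix algebras `M_n(D)`. -/
def Proj : Type _ := Σ n : ℕ, {p : Matrix (Fin n) (Fin n) D // IsStarProjection p}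

instance projSetoid : Setoid (Proj D) where
  r p q := MvN p.2.1 q.2.1
  iseqv := ⟨fun p => MvN.refl p.2.2, fun h => h.symm,
    fun {p _ r} h h' => MvN.trans p.2.2 r.2.2 h h'⟩

/-- `V(D)`: Murray–von Neumann classes of projections in matrix algebras over `D`. -/
def V : Type _ := Quotient (projSetoid D)

variable {D}

/-- The class in `V(D)` of a projection in `M_n(D)`. -/
def V.mk {n : ℕ} (p : Matrix (Fin n) (Fin n) D) (hp : IsStarProjection p) : V D :=
  Quotient.mk (projSetoid D) ⟨n, p, hp⟩

lemma V.mk_eq_iff {m n : ℕ} {p : Matrix (Fin m) (Fin m) D} {q : Matrix (Fin n) (Fin n) D}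
    {hp : IsStarProjection p} {hq : IsStarProjection q} :
    V.mk p hp = V.mk q hq ↔ MvN p q :=
  ⟨fun h => Quotient.exact h, fun h => Quotient.sound h⟩

lemma V.ind {P : V D → Prop}
    (h : ∀ (n : ℕ) (p : Matrix (Fin n) (Fin n) D) (hp : IsStarProjection p), P (V.mk p hp))
    (x : V D) : P x :=
  Quotient.ind (fun p => h p.1 p.2.1 p.2.2) x

/-- Addition on `V(D)` is `[p] + [q] = [p ⊕ q]`. -/
instance : Add (V D) where
  add := Quotient.map₂
    (fun p q => ⟨p.1 + q.1, dsum p.2.1 q.2.1, isStarProjection_dsum p.2.2 q.2.2⟩)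
    (by
      rintro ⟨_, p, hp⟩ ⟨_, p', hp'⟩ h ⟨_, q, hq⟩ ⟨_, q', hq'⟩ h'
      exact MvN.trans (isStarProjection_dsum hp hq) (isStarProjection_dsum hp' hq')
        (MvN.dsum_fromBlocks hp hq)
        (MvN.trans (isStarProjection_fromBlocks hp hq) (isStarProjection_dsum hp' hq')
          (MvN.fromBlocks h h') (MvN.dsum_fromBlocks hp' hq').symm))

lemma V.mk_add_mk {m n : ℕ} {p : Matrix (Fin m) (Fin m) D} {q : Matrix (Fin n) (Fin n) D}
    (hp : IsStarProjection p) (hq : IsStarProjection q) :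
    V.mk p hp + V.mk q hq = V.mk (dsum p q) (isStarProjection_dsum hp hq) := rfl

instance : Zero (V D) where
  zero := V.mk (0 : Matrix (Fin 0) (Fin 0) D) (.zero _)

lemma V.mk_zero (n : ℕ) : V.mk (0 : Matrix (Fin n) (Fin n) D) (.zero _) = 0 :=
  V.mk_eq_iff.2 ⟨0, by simp, by simp⟩

instance : AddCommMonoid (V D) where
  add_assoc := by
    intro x y z
    induction x using V.ind with | _ l p hp => ?_
    induction y using V.ind with | _ m q hq => ?_
    induction z using V.ind with | _ n r hr => ?_
    simp only [V.mk_add_mk]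
    rw [V.mk_eq_iff]
    have h1 := isStarProjection_dsum hp hq
    have h2 := isStarProjection_dsum hq hr
    have hpq := isStarProjection_fromBlocks hp hq
    have hqr := isStarProjection_fromBlocks hq hr
    refine MvN.trans (isStarProjection_dsum h1 hr) (isStarProjection_dsum hp h2)
      (MvN.dsum_fromBlocks h1 hr) ?_
    refine MvN.trans (isStarProjection_fromBlocks h1 hr) (isStarProjection_dsum hp h2)
      (MvN.fromBlocks (MvN.dsum_fromBlocks hp hq) (MvN.refl hr)) ?_
    refine MvN.trans (isStarProjection_fromBlocks hpq hr) (isStarProjection_dsum hp h2) ?_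
      (MvN.dsum_fromBlocks hp h2).symm
    refine MvN.trans (isStarProjection_fromBlocks hpq hr) (isStarProjection_fromBlocks hp h2) ?_
      (MvN.fromBlocks (MvN.refl hp) (MvN.dsum_fromBlocks hq hr)).symm
    have key : (Matrix.fromBlocks (Matrix.fromBlocks p 0 0 q) 0 0 r).submatrix
        (Equiv.sumAssoc (Fin l) (Fin m) (Fin n)).symm
        (Equiv.sumAssoc (Fin l) (Fin m) (Fin n)).symm
        = Matrix.fromBlocks p 0 0 (Matrix.fromBlocks q 0 0 r) := by
      ext (i | i | i) (j | j | j) <;> rfl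
    rw [← key]
    exact MvN.submatrix (isStarProjection_fromBlocks hpq hr) _
  zero_add := by
    intro x
    induction x using V.ind with | _ n p hp => ?_
    refine V.mk_eq_iff.2 (MvN.trans (isStarProjection_dsum (.zero _) hp) hp
      (MvN.dsum_fromBlocks (.zero _) hp) (MvN.symm ?_))
    have key : (Matrix.fromBlocks (0 : Matrix (Fin 0) (Fin 0) D) 0 0 p) =
        p.submatrix (Equiv.emptySum (Fin 0) (Fin n)) (Equiv.emptySum (Fin 0) (Fin n)) := by
      ext (i | i) (j | j)
      · exact i.elim0
      · exact i.elim0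
      · exact j.elim0
      · rfl
    rw [key]
    exact MvN.submatrix hp _
  add_zero := by
    intro x
    induction x using V.ind with | _ n p hp => ?_
    refine V.mk_eq_iff.2 (MvN.trans (isStarProjection_dsum hp (.zero _)) hp
      (MvN.dsum_fromBlocks hp (.zero _)) (MvN.symm ?_))
    have key : (Matrix.fromBlocks p 0 0 (0 : Matrix (Fin 0) (Fin 0) D)) =
        p.submatrix (Equiv.sumEmpty (Fin n) (Fin 0)) (Equiv.sumEmpty (Fin n) (Fin 0)) := by
      ext (i | i) (j | j)
      · rfl
      · exact j.elim0
      · exact i.elim0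
      · exact i.elim0
    rw [key]
    exact MvN.submatrix hp _
  add_comm := by
    intro x y
    induction x using V.ind with | _ m p hp => ?_
    induction y using V.ind with | _ n q hq => ?_
    rw [V.mk_add_mk, V.mk_add_mk, V.mk_eq_iff]
    refine MvN.trans (isStarProjection_dsum hp hq) (isStarProjection_dsum hq hp)
      (MvN.dsum_fromBlocks hp hq) ?_
    refine MvN.trans (isStarProjection_fromBlocks hp hq) (isStarProjection_dsum hq hp) ?_
      (MvN.dsum_fromBlocks hq hp).symm
    have key : (Matrix.fromBlocks p 0 0 q).submatrix
        (Equiv.sumComm (Fin n) (Fin m)) (Equiv.sumComm (Fin n) (Fin m))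
        = Matrix.fromBlocks q 0 0 p := by
      ext (i | i) (j | j) <;> rfl
    rw [← key]
    exact MvN.submatrix (isStarProjection_fromBlocks hp hq) _
  nsmul := nsmulRec

end Semigroup

section Functoriality

variable {D E F : Type*} [NonUnitalRing D] [StarRing D] [Module ℂ D]
  [NonUnitalRing E] [StarRing E] [Module ℂ E] [NonUnitalRing F] [StarRing F] [Module ℂ F]

lemma map_mul_matrix {ι κ μ : Type*} [Fintype κ] (f : D →⋆ₙₐ[ℂ] E)
    (a : Matrix ι κ D) (b : Matrix κ μ D) : (a * b).map f = a.map f * b.map f := by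
  ext i j
  simp [Matrix.mul_apply, map_sum]

lemma map_conjTranspose_matrix {ι κ : Type*} (f : D →⋆ₙₐ[ℂ] E) (a : Matrix ι κ D) :
    aᴴ.map f = (a.map f)ᴴ := by
  ext i j
  simp [Matrix.conjTranspose_apply, map_star]

lemma isStarProjection_map {ι : Type*} [Fintype ι] (f : D →⋆ₙₐ[ℂ] E) {p : Matrix ι ι D}
    (hp : IsStarProjection p) : IsStarProjection (p.map f) where
  isIdempotentElem := by
    rw [IsIdempotentElem, ← map_mul_matrix, isStarProjection_mul_self hp]
  isSelfAdjoint := by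
    rw [IsSelfAdjoint, Matrix.star_eq_conjTranspose, ← map_conjTranspose_matrix,
      isStarProjection_conjTranspose hp]

/-- The map `V(D) → V(E)` induced by a `*`-homomorphism, applied entrywise to matrices. -/
def V.map (f : D →⋆ₙₐ[ℂ] E) : V D →+ V E where
  toFun := Quotient.map (fun p => ⟨p.1, p.2.1.map f, isStarProjection_map f p.2.2⟩) (by
    rintro ⟨_, p, hp⟩ ⟨_, q, hq⟩ ⟨v, h1, h2⟩
    refine ⟨v.map f, ?_, ?_⟩
    · rw [← map_conjTranspose_matrix, ← map_mul_matrix, h1]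
    · rw [← map_conjTranspose_matrix, ← map_mul_matrix, h2])
  map_zero' := by
    refine V.mk_eq_iff.2 ⟨0, ?_, ?_⟩ <;> ext i <;> exact i.elim0
  map_add' := by
    intro x y
    induction x using V.ind with | _ m p hp => ?_
    induction y using V.ind with | _ n q hq => ?_
    have h : (dsum p q).map f = dsum (p.map f) (q.map f) := by
      simp only [dsum, ← Matrix.submatrix_map, Matrix.fromBlocks_map]
      congr 2 <;> ext <;> simp
    exact congrArg (Quotient.mk (projSetoid E))
      (congrArg (Sigma.mk (m + n)) (Subtype.ext h))

lemma V.map_mk (f : D →⋆ₙₐ[ℂ] E) {n : ℕ} (p : Matrix (Fin n) (Fin n) D)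
    (hp : IsStarProjection p) :
    V.map f (V.mk p hp) = V.mk (p.map f) (isStarProjection_map f hp) := rfl

lemma V.map_map (g : E →⋆ₙₐ[ℂ] F) (f : D →⋆ₙₐ[ℂ] E) (x : V D) :
    V.map g (V.map f x) = V.map (g.comp f) x := by
  induction x using V.ind with | _ n p hp => rfl

lemma V.map_zero_hom (x : V D) : V.map (0 : D →⋆ₙₐ[ℂ] E) x = 0 := by
  induction x using V.ind with | _ n p hp => ?_
  rw [V.map_mk, ← V.mk_zero n]
  rfl

variable (D) in
/-- The Grothendieck group of `V(D)`. For unital `D` this is `K_0(D)`. -/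
abbrev K00 : Type _ := Algebra.GrothendieckAddGroup (V D)

/-- The map `K00(D) → K00(E)` with `[p] - [q] ↦ [f(p)] - [f(q)]`. -/
def K00.map (f : D →⋆ₙₐ[ℂ] E) : K00 D →+ K00 E :=
  Algebra.GrothendieckAddGroup.lift (Algebra.GrothendieckAddGroup.of.comp (V.map f))

lemma K00.map_of (f : D →⋆ₙₐ[ℂ] E) (x : V D) :
    K00.map f (Algebra.GrothendieckAddGroup.of x) =
      Algebra.GrothendieckAddGroup.of (V.map f x) :=
  DFunLike.congr_fun (Algebra.GrothendieckAddGroup.lift.symm_apply_apply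
    (Algebra.GrothendieckAddGroup.of.comp (V.map f))) x

lemma K00.map_map (g : E →⋆ₙₐ[ℂ] F) (f : D →⋆ₙₐ[ℂ] E) (x : K00 D) :
    K00.map g (K00.map f x) = K00.map (g.comp f) x := by
  have h : (K00.map g).comp (K00.map f) = K00.map (g.comp f) := by
    apply Algebra.GrothendieckAddGroup.lift.symm.injective
    ext y
    simp only [Algebra.GrothendieckAddGroup.lift_symm_apply, AddMonoidHom.comp_apply]
    rw [K00.map_of, K00.map_of, K00.map_of, V.map_map]
  exact DFunLike.congr_fun h x

end Functoriality

/-! ### `K_0` of a (not necessarily unital) C⋆-algebra, with its order -/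

section KZero

/-- The canonical character `A⁺ → ℂ` of the unitization, with kernel `A`. -/
def augmentation (A : Type*) [NonUnitalCStarAlgebra A] : Unitization ℂ A →⋆ₙₐ[ℂ] ℂ where
  toFun x := x.fst
  map_smul' _ _ := rfl
  map_zero' := rfl
  map_add' _ _ := rfl
  map_mul' _ _ := rfl
  map_star' _ := rfl

/-- `K_0(A)`, the kernel of `K00(A⁺) → K00(ℂ)`, where `A⁺` is the unitization of `A`. -/
def K0 (A : Type*) [NonUnitalCStarAlgebra A] : Type _ :=
  (K00.map (augmentation A)).ker

instance (A : Type*) [NonUnitalCStarAlgebra A] : AddCommGroup (K0 A) :=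
  inferInstanceAs (AddCommGroup (K00.map (augmentation A)).ker)

/-- The map `A⁺ → B⁺` induced by `f : A → B`. -/
def unitizationMap {A B : Type*} [NonUnitalCStarAlgebra A] [NonUnitalCStarAlgebra B]
    (f : A →⋆ₙₐ[ℂ] B) : Unitization ℂ A →⋆ₐ[ℂ] Unitization ℂ B :=
  Unitization.starMap f

lemma augmentation_comp_unitizationMap {A B : Type*} [NonUnitalCStarAlgebra A]
    [NonUnitalCStarAlgebra B] (f : A →⋆ₙₐ[ℂ] B) :
    (augmentation B).comp (unitizationMap f).toNonUnitalStarAlgHom = augmentation A := by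
  ext x
  change (algebraMap ℂ (Unitization ℂ B) x.fst + (f x.snd : Unitization ℂ B)).fst = x.fst
  simp [Unitization.algebraMap_eq_inl]

/-- The homomorphism `K_0(A) → K_0(B)` induced by a `*`-homomorphism `A → B`. -/
def K0.map {A B : Type*} [NonUnitalCStarAlgebra A] [NonUnitalCStarAlgebra B]
    (f : A →⋆ₙₐ[ℂ] B) : K0 A →+ K0 B :=
  ((K00.map (unitizationMap f).toNonUnitalStarAlgHom).comp
    (K00.map (augmentation A)).ker.subtype).codRestrict (K00.map (augmentation B)).ker (by
      rintro ⟨x, hx⟩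
      rw [AddMonoidHom.mem_ker] at hx ⊢
      rw [AddMonoidHom.comp_apply, K00.map_map, augmentation_comp_unitizationMap]
      exact hx)

/-- The canonical map `V(A) → K_0(A)`, sending a projection over `A ⊂ A⁺` to its class. -/
def K0.ofV (A : Type*) [NonUnitalCStarAlgebra A] : V A →+ K0 A :=
  (Algebra.GrothendieckAddGroup.of.comp
    (V.map (Unitization.inrNonUnitalStarAlgHom ℂ A))).codRestrict
      (K00.map (augmentation A)).ker (by
        intro x
        have h : (augmentation A).comp (Unitization.inrNonUnitalStarAlgHom ℂ A) = 0 := by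
          ext a
          rfl
        rw [AddMonoidHom.mem_ker, AddMonoidHom.comp_apply, K00.map_of, V.map_map, h,
          V.map_zero_hom, map_zero])

/-- The positive cone `K_0(A)₊`: the classes of projections in matrix algebras over `A`. -/
def K0.positive (A : Type*) [NonUnitalCStarAlgebra A] : AddSubmonoid (K0 A) :=
  AddMonoidHom.mrange (K0.ofV A)

/-- The order on `K_0(A)`: `x ≤ y` iff `y - x ∈ K_0(A)₊`. In general it is only a preorder. -/
instance (A : Type*) [NonUnitalCStarAlgebra A] : Preorder (K0 A) where
  le x y := y - x ∈ K0.positive A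
  le_refl x := by
    rw [sub_self]
    exact zero_mem _
  le_trans x y z hxy hyz := by
    have := add_mem (show z - y ∈ K0.positive A from hyz) (show y - x ∈ K0.positive A from hxy)
    rwa [sub_add_sub_cancel] at this

end KZero

/-! ### `K_1` -/

section KOne

/-- The unitary group `U_n(D)` of `M_n(D)`, with the topology of entrywise (equivalently, norm)
convergence. -/
abbrev U (n : ℕ) (D : Type*) [CStarAlgebra D] : Type _ := unitary (Matrix (Fin n) (Fin n) D)

section Pad

variable {D : Type*} [CStarAlgebra D]

/-- The matrix `u ⊕ 1` of size `n`, for `u` of size `m ≤ n`. -/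
def padMatrix {m n : ℕ} (_h : m ≤ n) (u : Matrix (Fin m) (Fin m) D) :
    Matrix (Fin n) (Fin n) D :=
  fun i j => if h : i.1 < m ∧ j.1 < m then u ⟨i.1, h.1⟩ ⟨j.1, h.2⟩ else if i = j then 1 else 0

lemma padMatrix_self {m : ℕ} (h : m ≤ m) (u : Matrix (Fin m) (Fin m) D) :
    padMatrix h u = u := by
  ext i j
  simp [padMatrix]

lemma padMatrix_padMatrix {l m n : ℕ} (h : l ≤ m) (h' : m ≤ n) (u : Matrix (Fin l) (Fin l) D) :
    padMatrix h' (padMatrix h u) = padMatrix (h.trans h') u := by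
  ext i j
  by_cases h1 : i.1 < l ∧ j.1 < l
  · have h2 : i.1 < m ∧ j.1 < m := ⟨by omega, by omega⟩
    simp [padMatrix, h1, h2]
  · by_cases h2 : i.1 < m ∧ j.1 < m
    · simp [padMatrix, h1, h2, Fin.ext_iff]
    · simp [padMatrix, h1, h2]

lemma padMatrix_one {m n : ℕ} (h : m ≤ n) :
    padMatrix h (1 : Matrix (Fin m) (Fin m) D) = 1 := by
  ext i j
  simp only [padMatrix, Matrix.one_apply, Fin.ext_iff]
  split_ifs <;> rfl

lemma padMatrix_conjTranspose {m n : ℕ} (h : m ≤ n) (u : Matrix (Fin m) (Fin m) D) :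
    padMatrix h uᴴ = (padMatrix h u)ᴴ := by
  ext i j
  simp only [padMatrix, Matrix.conjTranspose_apply, Fin.ext_iff]
  split_ifs <;> first | rfl | (exfalso; omega) | simp

lemma padMatrix_eq_submatrix {m n : ℕ} (h : m ≤ n) (u : Matrix (Fin m) (Fin m) D) :
    padMatrix h u = (Matrix.fromBlocks u 0 0 (1 : Matrix (Fin (n - m)) (Fin (n - m)) D)).submatrix
      (finSumFinEquiv.trans (finCongr (Nat.add_sub_cancel' h))).symm
      (finSumFinEquiv.trans (finCongr (Nat.add_sub_cancel' h))).symm := by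
  set e := finSumFinEquiv.trans (finCongr (Nat.add_sub_cancel' h)) with he
  have : (padMatrix h u).submatrix e e = Matrix.fromBlocks u 0 0 1 := by
    ext (i | i) (j | j)
    · simp [padMatrix, he]
    · simp [padMatrix, he, Fin.ext_iff]
      intro; omega
    · simp [padMatrix, he, Fin.ext_iff]
      intro; omega
    · simp [padMatrix, he, Fin.ext_iff, Matrix.one_apply]
  rw [← this]
  ext i j
  simp

lemma padMatrix_mul {m n : ℕ} (h : m ≤ n) (u v : Matrix (Fin m) (Fin m) D) :
    padMatrix h (u * v) = padMatrix h u * padMatrix h v := by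
  rw [padMatrix_eq_submatrix, padMatrix_eq_submatrix h u, padMatrix_eq_submatrix h v,
    Matrix.submatrix_mul_equiv, Matrix.fromBlocks_multiply]
  simp

lemma continuous_padMatrix {m n : ℕ} (h : m ≤ n) :
    Continuous (padMatrix h : Matrix (Fin m) (Fin m) D → Matrix (Fin n) (Fin n) D) := by
  refine continuous_matrix fun i j => ?_
  by_cases h1 : i.1 < m ∧ j.1 < m
  · simpa [padMatrix, h1] using continuous_id.matrix_elem _ _
  · simpa [padMatrix, h1] using continuous_const

/-- The embedding `U_m(D) → U_n(D)`, `u ↦ u ⊕ 1`. -/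
def pad {m n : ℕ} (h : m ≤ n) : U m D →* U n D where
  toFun u := ⟨padMatrix h u.1, by
    rw [Unitary.mem_iff, Matrix.star_eq_conjTranspose, ← padMatrix_conjTranspose,
      ← padMatrix_mul, ← padMatrix_mul, ← Matrix.star_eq_conjTranspose,
      Unitary.star_mul_self_of_mem u.2, Unitary.mul_star_self_of_mem u.2]
    exact ⟨padMatrix_one h, padMatrix_one h⟩⟩
  map_one' := Subtype.ext (padMatrix_one h)
  map_mul' u v := Subtype.ext (padMatrix_mul h u.1 v.1)

lemma continuous_pad {m n : ℕ} (h : m ≤ n) : Continuous (pad h : U m D →* U n D) :=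
  ((continuous_padMatrix h).comp continuous_subtype_val).subtype_mk _

end Pad

/-- The group `U_n(D) / U_n(D)_0` of homotopy classes of unitaries in `M_n(D)`; here `U_n(D)_0` is
the path component of the identity. -/
abbrev PiZeroU (n : ℕ) (D : Type*) [CStarAlgebra D] : Type _ :=
  U n D ⧸ Subgroup.pathComponentOne (U n D)

lemma pathComponentOne_le_comap {G H : Type*} [Group G] [TopologicalSpace G]
    [IsTopologicalGroup G] [Group H] [TopologicalSpace H] [IsTopologicalGroup H]
    (f : G →* H) (hf : Continuous f) :
    Subgroup.pathComponentOne G ≤ (Subgroup.pathComponentOne H).comap f := by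
  intro g hg
  have hg' : Joined (1 : G) g := hg
  have := hg'.map hf
  rw [map_one] at this
  exact this

/-- The map `U_m(D) / U_m(D)_0 → U_n(D) / U_n(D)_0`, `[u] ↦ [u ⊕ 1]`, for `m ≤ n`. -/
def padPiZero (D : Type*) [CStarAlgebra D] (m n : ℕ) (h : m ≤ n) :
    PiZeroU m D →* PiZeroU n D :=
  QuotientGroup.map _ _ (pad h) (pathComponentOne_le_comap _ (continuous_pad h))

instance directedSystem_padPiZero (D : Type*) [CStarAlgebra D] :
    DirectedSystem (fun n => PiZeroU n D) (padPiZero D · · ·) where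
  map_self := by
    rintro m ⟨u⟩
    exact congrArg _ (Subtype.ext (padMatrix_self le_rfl u.1))
  map_map := by
    rintro n m l h h' ⟨u⟩
    exact congrArg _ (Subtype.ext (padMatrix_padMatrix h h' u.1))

/-- `K_1(D) = lim_n U_n(D) / U_n(D)_0` for a unital C⋆-algebra `D`. -/
def K1Unital (D : Type*) [CStarAlgebra D] : Type _ :=
  DirectLimit (fun n => PiZeroU n D) (padPiZero D)

instance (D : Type*) [CStarAlgebra D] : Group (K1Unital D) :=
  inferInstanceAs (Group (DirectLimit (fun n => PiZeroU n D) (padPiZero D)))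

section Functoriality

variable {D E : Type*} [CStarAlgebra D] [CStarAlgebra E]

/-- The map `U_n(D) → U_n(E)` obtained by applying a unital `*`-homomorphism entrywise. -/
def U.map (n : ℕ) (f : D →⋆ₐ[ℂ] E) : U n D →* U n E where
  toFun u := ⟨u.1.map f, by
    have h1 : star (u.1.map f) = (star u.1).map f :=
      (map_conjTranspose_matrix f.toNonUnitalStarAlgHom u.1).symm
    have h2 : ∀ a b : Matrix (Fin n) (Fin n) D, a.map f * b.map f = (a * b).map f :=
      fun a b => (map_mul_matrix f.toNonUnitalStarAlgHom a b).symm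
    have h3 : (1 : Matrix (Fin n) (Fin n) D).map f = 1 :=
      Matrix.map_one f (map_zero f) (map_one f)
    rw [Unitary.mem_iff, h1, h2, h2, Unitary.star_mul_self_of_mem u.2,
      Unitary.mul_star_self_of_mem u.2]
    exact ⟨h3, h3⟩⟩
  map_one' := Subtype.ext (Matrix.map_one f (map_zero f) (map_one f))
  map_mul' u v := Subtype.ext (map_mul_matrix f.toNonUnitalStarAlgHom u.1 v.1)

lemma U.continuous_map (n : ℕ) (f : D →⋆ₐ[ℂ] E) : Continuous (U.map n f) :=
  (continuous_subtype_val.matrix_map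
    (NonUnitalStarAlgHom.instContinuousLinearMapClassComplex.map_continuous f)).subtype_mk _

/-- The map `U_n(D) / U_n(D)_0 → U_n(E) / U_n(E)_0`, `[u] ↦ [f(u)]`. -/
def PiZeroU.map (n : ℕ) (f : D →⋆ₐ[ℂ] E) : PiZeroU n D →* PiZeroU n E :=
  QuotientGroup.map _ _ (U.map n f) (pathComponentOne_le_comap _ (U.continuous_map n f))

lemma PiZeroU.map_pad (f : D →⋆ₐ[ℂ] E) (m n : ℕ) (h : m ≤ n) (x : PiZeroU m D) :
    padPiZero E m n h (PiZeroU.map m f x) = PiZeroU.map n f (padPiZero D m n h x) := by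
  obtain ⟨u, rfl⟩ := QuotientGroup.mk_surjective x
  refine congrArg (QuotientGroup.mk' _) (Subtype.ext ?_)
  ext i j
  change padMatrix h (u.1.map f) i j = f (padMatrix h u.1 i j)
  simp only [padMatrix, Matrix.map_apply]
  split_ifs <;> simp

/-- The homomorphism `K_1(D) → K_1(E)`, `[u] ↦ [f(u)]`, for unital `f : D → E`. -/
def K1Unital.map (f : D →⋆ₐ[ℂ] E) : K1Unital D →* K1Unital E :=
  MonoidHom.mk'
    (DirectLimit.map (padPiZero D) (padPiZero E) (fun n => PiZeroU.map n f)
      (fun m n h x => PiZeroU.map_pad f m n h x))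
    (by
      intro x y
      obtain ⟨n, a, b, rfl, rfl⟩ := DirectLimit.exists_eq_mk₂ (padPiZero D) x y
      change DirectLimit.map (padPiZero D) (padPiZero E) _ _
        ((⟦⟨n, a⟩⟧ : DirectLimit _ (padPiZero D)) * ⟦⟨n, b⟩⟧) =
        (⟦⟨n, PiZeroU.map n f a⟩⟧ : DirectLimit _ (padPiZero E)) * ⟦⟨n, PiZeroU.map n f b⟩⟧
      rw [DirectLimit.mul_def, DirectLimit.mul_def, ← map_mul]
      rfl)

end Functoriality

/-- `K_1(A) = K_1(A⁺)`, where `A⁺` is the unitization of `A`. The group is written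
multiplicatively. -/
abbrev K1 (A : Type*) [NonUnitalCStarAlgebra A] : Type _ := K1Unital (Unitization ℂ A)

/-- The homomorphism `K_1(A) → K_1(B)` induced by a `*`-homomorphism `A → B`. -/
def K1.map {A B : Type*} [NonUnitalCStarAlgebra A] [NonUnitalCStarAlgebra B]
    (f : A →⋆ₙₐ[ℂ] B) : K1 A →* K1 B :=
  K1Unital.map (unitizationMap f)

end KOne

end CStarKTheory

end

/-! The argument is of Löwenheim–Skolem type. Each assertion to be secured says that something which
happens over `N⁺` already happens over `B⁺`, and each is existential: a finite tuple of inputs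
admits a finite tuple of witnesses. Countably many relations suffice, but the inputs are
uncountable. So witnesses are added only near a countable dense set of inputs and for rational
radii; the process is iterated and the closure of the union is taken (`exists_saturation`). The
result is approximate in the inputs: an input over `B⁺` with witnesses over `N⁺` is a limit of
inputs over `B⁺` with witnesses over `B⁺`. The relation holds exactly for these nearby inputs, so it
need not be continuous.

Approximation is enough because K-theory classes are locally constant: nearby projections are
equivalent (`exists_nhds_mvN`) and nearby unitaries are homotopic (`U.exists_nhds_joined`).

For `K_0`, the image of `[a] - [b]` is the class of a projection `p` over `N` exactly when `a ⊕ r ∼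
b ⊕ p ⊕ r` for some `r`. Saturation then moves `p` and `r` into `B` and `B⁺`
(`K0.exists_eq_ofV_of_saturated`); empty `p` gives injectivity, general `p` gives the order. For
`K_1`, a path to `1` is not a finite tuple, but the identity component consists of the finite
products of exponentials `exp(ix)` with `x` self-adjoint, which are finite data
(`U.joined_one_of_saturated`). -/

open scoped Matrix

noncomputable section

open TopologicalSpace

/-! ### Separability of generated subalgebras -/

section Separability

lemma TopologicalSpace.IsSeparable.image2_mul {M : Type*} [TopologicalSpace M] [Mul M]
    [ContinuousMul M] {s t : Set M} (hs : IsSeparable s) (ht : IsSeparable t) :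
    IsSeparable (Set.image2 (· * ·) s t) := by
  rw [← Set.image_uncurry_prod]
  exact (hs.prod ht).image continuous_mul

lemma TopologicalSpace.IsSeparable.subsemigroupClosure {M : Type*} [TopologicalSpace M]
    [Semigroup M] [ContinuousMul M] {s : Set M} (hs : IsSeparable s) :
    IsSeparable (Subsemigroup.closure s : Set M) := by
  -- Each stage adjoins the products of pairs from the previous one; the stages increase, so their
  -- union is a subsemigroup.
  let P : ℕ → Set M := fun n => Nat.rec s (fun _ t => t ∪ Set.image2 (· * ·) t t) n
  have hP : ∀ n, IsSeparable (P n) := fun n => by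
    induction n with
    | zero => exact hs
    | succ n ih => exact ih.union (ih.image2_mul ih)
  have hmono : Monotone P := monotone_nat_of_le_succ fun n => Set.subset_union_left
  let Q : Subsemigroup M :=
    { carrier := ⋃ n, P n
      mul_mem' := by
        intro a b ha hb
        obtain ⟨i, hi⟩ := Set.mem_iUnion.1 ha
        obtain ⟨j, hj⟩ := Set.mem_iUnion.1 hb
        refine Set.mem_iUnion.2 ⟨max i j + 1, Or.inr ?_⟩
        exact Set.mem_image2_of_mem (hmono (le_max_left i j) hi) (hmono (le_max_right i j) hj) }
  refine (IsSeparable.iUnion hP).mono ?_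
  exact (Subsemigroup.closure_le (S := Q)).2 (Set.subset_iUnion P 0)

lemma TopologicalSpace.IsSeparable.starAdjoin {N : Type*} [NonUnitalCStarAlgebra N] {s : Set N}
    (hs : IsSeparable s) : IsSeparable (NonUnitalStarAlgebra.adjoin ℂ s : Set N) := by
  have h := NonUnitalStarAlgebra.adjoin_eq_span (R := ℂ) s
  have h' : (NonUnitalStarAlgebra.adjoin ℂ s : Set N) =
      Submodule.span ℂ (Subsemigroup.closure (s ∪ star s) : Set N) := by
    rw [← h]; rfl
  rw [h']
  refine IsSeparable.span (IsSeparable.subsemigroupClosure (hs.union ?_))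
  rw [← Set.image_star]
  exact hs.image continuous_star

end Separability

/-! ### Closing a separable subalgebra under countably many relations -/

namespace CStarKTheory

/-- A relation between finite tuples of elements of `R`: a tuple `x` of inputs and a tuple `y` of
witnesses. -/
structure TupleRel (R : Type*) where
  /-- The index set of the inputs. -/
  In : Type
  /-- The index set of the witnesses. -/
  Out : Type
  [finIn : Fintype In]
  [finOut : Fintype Out]
  /-- The relation. -/
  Holds : (In → R) → (Out → R) → Prop

attribute [instance] TupleRel.finIn TupleRel.finOut

section Saturation

variable {N : Type*}

/-- The tuples over `N⁺` whose `N`-components lie in `S`. -/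
def tuplesOver (ι : Type) (S : Set N) : Set (ι → Unitization ℂ N) :=
  {x | ∀ i, (x i).snd ∈ S}

lemma tuplesOver_mono (ι : Type) {S T : Set N} (h : S ⊆ T) : tuplesOver ι S ⊆ tuplesOver ι T :=
  fun _ hx i => h (hx i)

variable [NonUnitalCStarAlgebra N]

lemma isSeparable_tuplesOver (ι : Type) [Fintype ι] {S : Set N} (hS : IsSeparable S) :
    IsSeparable (tuplesOver ι S) := by
  refine isSeparable_pi (s := fun _ => {z : Unitization ℂ N | z.snd ∈ S}) fun _ => ?_
  have h : {z : Unitization ℂ N | z.snd ∈ S} ⊆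
      (fun w : ℂ × N => (algebraMap ℂ (Unitization ℂ N) w.1 + (w.2 : Unitization ℂ N))) ''
        (Set.univ ×ˢ S) := by
    intro z hz
    refine ⟨(z.fst, z.snd), ⟨trivial, hz⟩, ?_⟩
    ext <;> simp [Unitization.algebraMap_eq_inl]
  refine IsSeparable.mono (IsSeparable.image ((isSeparable_univ_iff.2 inferInstance).prod hS) ?_) h
  have h1 : Continuous (Unitization.inr : N → Unitization ℂ N) :=
    (Unitization.isometry_inr (𝕜 := ℂ) (A := N)).continuous
  exact ((continuous_algebraMap ℂ (Unitization ℂ N)).comp continuous_fst).add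
    (h1.comp continuous_snd)

/-- The tuple `s` need not satisfy the relation; it is only a centre near which solutions are
sought. This lets `s` range over a countable dense set and `ε` over the rationals, so that countably
many chosen solutions, inputs as well as witnesses, generate `C` together with `B`. -/
lemma exists_saturation_step {K : Type*} [Countable K] (R : K → TupleRel (Unitization ℂ N))
    (B : NonUnitalStarSubalgebra ℂ N) (hB : IsSeparable (B : Set N)) :
    ∃ C : NonUnitalStarSubalgebra ℂ N, IsSeparable (C : Set N) ∧ B ≤ C ∧
      ∀ k, ∀ s ∈ tuplesOver (R k).In (B : Set N), ∀ ε > 0,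
        (∃ x y, (R k).Holds x y ∧ dist x s < ε) →
        ∃ x ∈ tuplesOver (R k).In (C : Set N), ∃ y ∈ tuplesOver (R k).Out (C : Set N),
          (R k).Holds x y ∧ dist x s < ε := by
  choose c hcs hcc hcd using fun k =>
    (isSeparable_tuplesOver (R k).In hB).exists_countable_dense_subset
  have hc : ∀ k, Countable (c k) := fun k => (hcc k).to_subtype
  have hex : ∀ (t : Σ k, c k × {q : ℚ // 0 < q}), ∃ (x : (R t.1).In → Unitization ℂ N)
      (y : (R t.1).Out → Unitization ℂ N),
      (∃ x y, (R t.1).Holds x y ∧ dist x t.2.1.1 < (t.2.2.1 : ℝ)) →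
        (R t.1).Holds x y ∧ dist x t.2.1.1 < (t.2.2.1 : ℝ) := by
    intro t
    by_cases h : ∃ x y, (R t.1).Holds x y ∧ dist x t.2.1.1 < (t.2.2.1 : ℝ)
    · obtain ⟨x, y, h⟩ := h
      exact ⟨x, y, fun _ => h⟩
    -- Where no solution exists the choice is arbitrary.
    · exact ⟨0, 0, fun h' => (h h').elim⟩
  choose X Y hXY using hex
  let T : Set N := (B : Set N) ∪ ((⋃ t, Set.range fun i => (X t i).snd) ∪
    ⋃ t, Set.range fun i => (Y t i).snd)
  have hT : IsSeparable T := hB.union (Set.Countable.isSeparable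
    ((Set.countable_iUnion fun t => Set.countable_range _).union
      (Set.countable_iUnion fun t => Set.countable_range _)))
  have hsub : T ⊆ NonUnitalStarAlgebra.adjoin ℂ T := NonUnitalStarAlgebra.subset_adjoin ℂ T
  refine ⟨NonUnitalStarAlgebra.adjoin ℂ T, hT.starAdjoin,
    fun a ha => hsub (Or.inl ha), ?_⟩
  rintro k s hs ε hε ⟨x, y, hxy, hd⟩
  obtain ⟨s', hs', hss'⟩ := Metric.mem_closure_iff.1 (hcd k hs) ((ε - dist x s) / 2)
    (by linarith)
  -- The lower bound puts the given solution within `q` of `s'`; the upper bound puts every tuple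
  -- within `q` of `s'` within `ε` of `s`.
  obtain ⟨q, hq1, hq2⟩ := exists_rat_btwn
    (show dist x s + dist s s' < ε - dist s s' by linarith)
  have hq0 : (0 : ℚ) < q := by
    have : (0 : ℝ) < q := lt_of_le_of_lt (by positivity) hq1
    exact_mod_cast this
  let t : Σ k, c k × {q : ℚ // 0 < q} := ⟨k, ⟨s', hs'⟩, ⟨q, hq0⟩⟩
  have ht := hXY t ⟨x, y, hxy, (dist_triangle x s s').trans_lt hq1⟩
  refine ⟨X t, fun i => hsub (Or.inr (Or.inl (Set.mem_iUnion.2 ⟨t, i, rfl⟩))), Y t,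
    fun i => hsub (Or.inr (Or.inr (Set.mem_iUnion.2 ⟨t, i, rfl⟩))), ht.1, ?_⟩
  have h1 : dist (X t) s' < q := ht.2
  have := dist_triangle (X t) s' s
  rw [dist_comm s' s] at this
  linarith

lemma exists_saturation {K : Type*} [Countable K] (R : K → TupleRel (Unitization ℂ N))
    (A : NonUnitalStarSubalgebra ℂ N) (hA : IsSeparable (A : Set N)) :
    ∃ B : NonUnitalStarSubalgebra ℂ N, IsClosed (B : Set N) ∧ IsSeparable (B : Set N) ∧ A ≤ B ∧
      ∀ k x y, (R k).Holds x y → x ∈ tuplesOver (R k).In (B : Set N) → ∀ ε > 0,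
        ∃ x' ∈ tuplesOver (R k).In (B : Set N), ∃ y' ∈ tuplesOver (R k).Out (B : Set N),
          (R k).Holds x' y' ∧ dist x' x < ε := by
  choose! step hsep hle hstep using fun B hB => exists_saturation_step R B hB
  let B : ℕ → NonUnitalStarSubalgebra ℂ N := fun n => step^[n] A
  have hB : ∀ n, B (n + 1) = step (B n) := fun n => Function.iterate_succ_apply' step n A
  have hBs : ∀ n, IsSeparable (B n : Set N) := fun n => by
    induction n with
    | zero => exact hA
    | succ n ih => rw [hB]; exact hsep (B n) ih
  have hmono : Monotone B := monotone_nat_of_le_succ fun n => by rw [hB]; exact hle _ (hBs n)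
  have hcoe : ((⨆ n, B n : NonUnitalStarSubalgebra ℂ N) : Set N) = ⋃ n, (B n : Set N) :=
    NonUnitalStarSubalgebra.coe_iSup_of_directed hmono.directed_le
  have hcl : ((⨆ n, B n).topologicalClosure : Set N) = closure (⋃ n, (B n : Set N)) := by
    rw [← hcoe]
    rfl
  have hsub : ∀ n, (B n : Set N) ⊆ ((⨆ n, B n).topologicalClosure : Set N) := fun n => by
    rw [hcl]
    exact (Set.subset_iUnion (fun n => (B n : Set N)) n).trans subset_closure
  refine ⟨(⨆ n, B n).topologicalClosure, ?_, ?_, hsub 0, ?_⟩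
  · rw [hcl]; exact isClosed_closure
  · rw [hcl]; exact (IsSeparable.iUnion hBs).closure
  intro k x y hxy hx ε hε
  have happ : ∀ i, ∃ b ∈ ⋃ n, (B n : Set N), dist (x i).snd b < ε / 4 := fun i =>
    Metric.mem_closure_iff.1 (by rw [← hcl]; exact hx i) _ (by positivity)
  choose b hb hbd using happ
  choose m hm using fun i => Set.mem_iUnion.1 (hb i)
  -- A tuple has finitely many entries, so all the approximants lie in one stage. The scalar parts
  -- of `x` are kept, hence `x` and `s` differ only in their `N`-components.
  let n := Finset.univ.sup m
  let s : (R k).In → Unitization ℂ N := fun i => Unitization.inl (x i).fst + (b i : Unitization ℂ N)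
  have hs : s ∈ tuplesOver (R k).In (B n : Set N) := fun i => by
    have : (s i).snd = b i := by simp [s]
    rw [this]
    exact hmono (Finset.le_sup (Finset.mem_univ i)) (hm i)
  have hd : dist x s < ε / 2 := by
    refine lt_of_le_of_lt ((dist_pi_le_iff (by positivity : (0 : ℝ) ≤ ε / 4)).2 fun i => ?_)
      (by linarith)
    have : x i - s i = ((((x i).snd - b i : N)) : Unitization ℂ N) := by
      rw [sub_eq_iff_eq_add]
      ext <;> simp [s, -Unitization.inr_sub]
    rw [dist_eq_norm, this, Unitization.norm_inr, ← dist_eq_norm]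
    exact (hbd i).le
  obtain ⟨x', hx', y', hy', hxy', hd'⟩ :=
    hstep (B n) (hBs n) k s hs (ε / 2) (by positivity) ⟨x, y, hxy, hd⟩
  rw [← hB] at hx' hy'
  refine ⟨x', tuplesOver_mono _ (hsub (n + 1)) hx', y', tuplesOver_mono _ (hsub (n + 1)) hy',
    hxy', ?_⟩
  have := dist_triangle x' s x
  rw [dist_comm s x] at this
  linarith

/-- The inclusion `B⁺ → N⁺`. -/
abbrev unitizationIncl (B : NonUnitalStarSubalgebra ℂ N) [IsClosed (B : Set N)] :
    Unitization ℂ B →⋆ₐ[ℂ] Unitization ℂ N :=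
  unitizationMap (NonUnitalStarSubalgebraClass.subtype B)

lemma unitizationIncl_injective (B : NonUnitalStarSubalgebra ℂ N) [IsClosed (B : Set N)] :
    Function.Injective (unitizationIncl B) :=
  Unitization.starMap_injective Subtype.val_injective

lemma unitizationIncl_apply (B : NonUnitalStarSubalgebra ℂ N) [IsClosed (B : Set N)]
    (z : Unitization ℂ B) :
    unitizationIncl B z = Unitization.inl z.fst + ((z.snd : N) : Unitization ℂ N) := by
  change algebraMap ℂ (Unitization ℂ N) z.fst + _ = _
  rw [Unitization.algebraMap_eq_inl]
  rfl

/-- A separable C⋆-subalgebra can be enlarged to a separable C⋆-subalgebra `B` such that, for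
countably many given relations, inputs in `B⁺` that have witnesses in `N⁺` can be approximated
by inputs in `B⁺` that have witnesses in `B⁺`. -/
theorem exists_separable_saturated {K : Type*} [Countable K]
    (R : K → TupleRel (Unitization ℂ N)) (A : NonUnitalStarSubalgebra ℂ N)
    (hA : IsSeparable (A : Set N)) :
    ∃ (B : NonUnitalStarSubalgebra ℂ N) (_ : IsClosed (B : Set N)), IsSeparable (B : Set N) ∧
      A ≤ B ∧ ∀ k (x : (R k).In → Unitization ℂ B) y, (R k).Holds (unitizationIncl B ∘ x) y →
        ∀ W ∈ nhds x, ∃ x' ∈ W, ∃ y' : (R k).Out → Unitization ℂ B,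
          (R k).Holds (unitizationIncl B ∘ x') (unitizationIncl B ∘ y') := by
  obtain ⟨B, hBc, hBs, hAB, h⟩ := exists_saturation R A hA
  refine ⟨B, hBc, hBs, hAB, fun k x y hxy W hW => ?_⟩
  have hlift : ∀ {ι : Type} {z : ι → Unitization ℂ N}, z ∈ tuplesOver ι (B : Set N) →
      ∃ w : ι → Unitization ℂ B, unitizationIncl B ∘ w = z := by
    intro ι z hz
    refine ⟨fun i => Unitization.inl (z i).fst + ((⟨(z i).snd, hz i⟩ : B) : Unitization ℂ B), ?_⟩
    funext i
    rw [Function.comp_apply, unitizationIncl_apply]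
    ext <;> simp
  have hover : unitizationIncl B ∘ x ∈ tuplesOver (R k).In (B : Set N) := fun i => by
    rw [Function.comp_apply, unitizationIncl_apply]
    simp
  obtain ⟨ε, hε, hεW⟩ := Metric.mem_nhds_iff.1 hW
  obtain ⟨x', hx', y', hy', hxy', hd⟩ := h k _ y hxy hover ε hε
  obtain ⟨x', rfl⟩ := hlift hx'
  obtain ⟨y', rfl⟩ := hlift hy'
  refine ⟨x', hεW ?_, y', hxy'⟩
  rw [Metric.mem_ball, dist_pi_lt_iff hε]
  intro i
  -- An injective `*`-homomorphism of C⋆-algebras is isometric, so closeness in `N⁺` is closeness in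
  -- `B⁺`.
  rw [← (NonUnitalStarAlgHom.isometry (unitizationIncl B) (unitizationIncl_injective B)).dist_eq]
  exact (dist_le_pi_dist _ _ i).trans_lt hd

end Saturation

end CStarKTheory

/-! ### Local constancy of classes of projections and unitaries -/

section CStarAlgebra

variable {E : Type*} [CStarAlgebra E]

/-- If `z` is invertible and intertwines the projections `p` and `q`, then `p` and `q` are
Murray–von Neumann equivalent. -/
lemma IsStarProjection.exists_partialIsometry_of_intertwine {p q z : E} (hp : IsStarProjection p)
    (hq : IsStarProjection q) (hz : IsUnit z) (hzp : z * p = q * z) :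
    ∃ v : E, star v * v = p ∧ v * star v = q := by
  let _ : PartialOrder E := CStarAlgebra.spectralOrder E
  have : StarOrderedRing E := CStarAlgebra.spectralOrderedRing E
  have hps : star p = p := hp.isSelfAdjoint
  have hqs : star q = q := hq.isSelfAdjoint
  have hpp : p * p = p := hp.isIdempotentElem
  have hpz : p * star z = star z * q := by
    have := congrArg star hzp
    rwa [star_mul, star_mul, hps, hqs] at this
  set a := star z * z with ha
  have hpos : IsStrictlyPositive a :=
    IsStrictlyPositive.iff_of_unital.2 ⟨star_mul_self_nonneg z, hz.star.mul hz⟩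
  -- Here `h = |z|⁻¹`, so `z * h` is the unitary part of the polar decomposition of `z`. It still
  -- carries `p` to `q`, since `p` commutes with `a` and hence with `h`; its restriction `z * h * p`
  -- is the required partial isometry.
  set h : E := a ^ (-(1 / 2) : ℝ) with hh
  have hah : h * a * h = 1 := CFC.conjugate_rpow_neg_one_half a hpos
  have hhs : star h = h := (CFC.rpow_nonneg (a := a) (y := -(1 / 2))).isSelfAdjoint
  have hcp : Commute h p := by
    have : Commute a p := by
      rw [Commute, SemiconjBy, ha, mul_assoc, hzp, ← mul_assoc, ← mul_assoc, hpz]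
    exact this.cfc_nnreal _
  have hca : Commute h a := (Commute.refl a).cfc_nnreal _
  have hinv : z * (h * h) * star z = 1 := by
    refine hz.star.mul_left_cancel ?_
    calc star z * (z * (h * h) * star z) = (a * h) * h * star z := by
          rw [ha]; simp only [mul_assoc]
      _ = star z * 1 := by rw [← hca.eq, hah, one_mul, mul_one]
  refine ⟨z * h * p, ?_, ?_⟩
  · calc star (z * h * p) * (z * h * p) = p * (h * (star z * z) * h) * p := by
          rw [star_mul, star_mul, hps, hhs]; simp only [mul_assoc]
      _ = p := by rw [← ha, hah, mul_one, hpp]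
  · calc z * h * p * star (z * h * p) = z * h * ((p * p) * h) * star z := by
          rw [star_mul, star_mul, hps, hhs]; simp only [mul_assoc]
      _ = z * (h * h) * (p * star z) := by rw [hpp, ← hcp.eq]; simp only [mul_assoc]
      _ = q := by rw [hpz, ← mul_assoc, hinv, one_mul]

/-- Projections close to `p` are Murray–von Neumann equivalent to `p`. -/
lemma IsStarProjection.exists_nhds_partialIsometry {p : E} (hp : IsStarProjection p) :
    ∃ W ∈ nhds p, ∀ q ∈ W, IsStarProjection q → ∃ v : E, star v * v = p ∧ v * star v = q := by
  have hpp : p * p = p := hp.isIdempotentElem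
  -- The value at `p` is `1`, so `f q` is invertible for `q` near `p`; moreover `f q * p = q * p = q
  -- * f q`.
  let f : E → E := fun q => q * p + (1 - q) * (1 - p)
  have hf : Continuous f := by fun_prop
  have hfp : f p = 1 := by simp [f, mul_sub, sub_mul, hpp]
  refine ⟨f ⁻¹' {z | IsUnit z}, hf.continuousAt.preimage_mem_nhds
    (Units.isOpen.mem_nhds (by rw [hfp]; exact isUnit_one)), fun q hq hqp => ?_⟩
  have hqq : q * q = q := hqp.isIdempotentElem
  refine hp.exists_partialIsometry_of_intertwine hqp hq ?_
  simp only [f, add_mul, mul_add, mul_sub, sub_mul, mul_one, one_mul, mul_assoc, hpp]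
  simp only [← mul_assoc, hqq]
  abel

lemma Unitary.exists_nhds_joined (u : unitary E) :
    ∃ W ∈ nhds (u : E), ∀ w : unitary E, (w : E) ∈ W → Joined u w := by
  refine ⟨Metric.ball (u : E) 2, Metric.ball_mem_nhds _ two_pos, fun w hw => ?_⟩
  exact Unitary.joined u w (by rwa [← dist_eq_norm])

/-- Replaces a path by finitely many elements of `E`, which for fixed `k` can serve as a tuple of
witnesses. -/
lemma Unitary.mem_pathComponentOne_iff_exists_exp {u : unitary E} :
    Joined 1 u ↔ ∃ (k : ℕ) (x : Fin k → E), (∀ i, IsSelfAdjoint (x i)) ∧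
      (List.ofFn fun i => NormedSpace.exp (Complex.I • x i)).prod = (u : E) := by
  have hval : ∀ l : List (selfAdjoint E), ((l.map selfAdjoint.expUnitary).prod : E) =
      (l.map fun x : selfAdjoint E => NormedSpace.exp (Complex.I • (x : E))).prod := fun l => by
    induction l with
    | nil => simp
    | cons a l ih => simp [ih]
  have := Unitary.mem_pathComponentOne_iff (u := u)
  refine this.trans ⟨?_, ?_⟩
  · rintro ⟨l, rfl⟩
    refine ⟨l.length, fun i => l.get i, fun i => (l.get i).2, ?_⟩
    rw [hval]
    conv_rhs => rw [← List.ofFn_get l, List.map_ofFn]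
    rfl
  · rintro ⟨k, x, hx, h⟩
    refine ⟨List.ofFn fun i => (⟨x i, hx i⟩ : selfAdjoint E), Subtype.ext ?_⟩
    rw [hval, ← h, List.map_ofFn]
    rfl

end CStarAlgebra

namespace CStarKTheory

/-! ### Transfer to matrix algebras -/

section Matrices

variable {D : Type*} [CStarAlgebra D] {n : ℕ}

/-- `CStarMatrix` puts the C⋆-norm on the same matrices without changing the topology, so the
C⋆-algebra result applies verbatim. The spectral order on `D` is only needed to have that norm. -/
lemma exists_nhds_mvN {p : Matrix (Fin n) (Fin n) D} (hp : IsStarProjection p) :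
    ∃ W ∈ nhds p, ∀ q ∈ W, IsStarProjection q → MvN p q := by
  let _ : PartialOrder D := CStarAlgebra.spectralOrder D
  have : StarOrderedRing D := CStarAlgebra.spectralOrderedRing D
  exact IsStarProjection.exists_nhds_partialIsometry (E := CStarMatrix (Fin n) (Fin n) D) hp

lemma U.exists_nhds_joined (u : U n D) :
    ∃ W ∈ nhds (u : Matrix (Fin n) (Fin n) D), ∀ w : U n D,
      (w : Matrix (Fin n) (Fin n) D) ∈ W → Joined u w := by
  let _ : PartialOrder D := CStarAlgebra.spectralOrder D
  have : StarOrderedRing D := CStarAlgebra.spectralOrderedRing D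
  exact Unitary.exists_nhds_joined (E := CStarMatrix (Fin n) (Fin n) D) u

lemma U.joined_one_iff {u : U n D} :
    Joined 1 u ↔ ∃ (k : ℕ) (x : Fin k → Matrix (Fin n) (Fin n) D), (∀ i, IsSelfAdjoint (x i)) ∧
      (List.ofFn fun i => NormedSpace.exp (Complex.I • x i)).prod = u.1 := by
  let _ : PartialOrder D := CStarAlgebra.spectralOrder D
  have : StarOrderedRing D := CStarAlgebra.spectralOrderedRing D
  exact Unitary.mem_pathComponentOne_iff_exists_exp (E := CStarMatrix (Fin n) (Fin n) D) (u := u)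

lemma map_exp_matrix {E : Type*} [CStarAlgebra E] (f : D →⋆ₐ[ℂ] E)
    (x : Matrix (Fin n) (Fin n) D) :
    (NormedSpace.exp x).map f = NormedSpace.exp (x.map f) := by
  let _ : PartialOrder D := CStarAlgebra.spectralOrder D
  have : StarOrderedRing D := CStarAlgebra.spectralOrderedRing D
  let _ : PartialOrder E := CStarAlgebra.spectralOrder E
  have : StarOrderedRing E := CStarAlgebra.spectralOrderedRing E
  let φ : CStarMatrix (Fin n) (Fin n) D →+* CStarMatrix (Fin n) (Fin n) E :=
    RingHom.mapMatrix (f : D →+* E)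
  have hφ : Continuous φ := Continuous.matrix_map (f := f) continuous_id
    (NonUnitalStarAlgHom.instContinuousLinearMapClassComplex.map_continuous f)
  let _ : NormedAlgebra ℚ (CStarMatrix (Fin n) (Fin n) D) := .restrictScalars ℚ ℂ _
  let _ : NormedAlgebra ℚ (CStarMatrix (Fin n) (Fin n) E) := .restrictScalars ℚ ℂ _
  exact NormedSpace.map_exp φ hφ x

end Matrices

/-! ### Matrices under entrywise homomorphisms -/

section Injective

variable {D E : Type*} [NonUnitalRing D] [StarRing D] [Module ℂ D]
  [NonUnitalRing E] [StarRing E] [Module ℂ E]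

lemma isStarProjection_of_map_injective {ι : Type*} [Fintype ι] {f : D →⋆ₙₐ[ℂ] E}
    (hf : Function.Injective f) {p : Matrix ι ι D} (hp : IsStarProjection (p.map f)) :
    IsStarProjection p where
  isIdempotentElem := Matrix.map_injective hf (by
    change (p * p).map f = p.map f
    rw [map_mul_matrix, isStarProjection_mul_self hp])
  isSelfAdjoint := Matrix.map_injective hf (by
    change pᴴ.map f = p.map f
    rw [map_conjTranspose_matrix, isStarProjection_conjTranspose hp])

lemma map_dsum (f : D →⋆ₙₐ[ℂ] E) {m n : ℕ} (p : Matrix (Fin m) (Fin m) D)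
    (q : Matrix (Fin n) (Fin n) D) : (dsum p q).map f = dsum (p.map f) (q.map f) := by
  simp only [dsum, ← Matrix.submatrix_map, Matrix.fromBlocks_map]
  congr 2 <;> ext <;> simp

end Injective

/-! ### Equality in the Grothendieck group -/

section Grothendieck

variable {D : Type*} [NonUnitalRing D] [StarRing D]

lemma K00.exists_eq_sub (x : K00 D) : ∃ a b : V D, x =
    Algebra.GrothendieckAddGroup.of a - Algebra.GrothendieckAddGroup.of b := by
  obtain ⟨⟨a, b⟩, h⟩ := (AddLocalization.addMonoidOf (⊤ : AddSubmonoid (V D))).surj x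
  exact ⟨a, b, eq_sub_of_add_eq h⟩

lemma K00.of_eq_of_iff {a b : V D} :
    (Algebra.GrothendieckAddGroup.of a : K00 D) = Algebra.GrothendieckAddGroup.of b ↔
      ∃ c, a + c = b + c := by
  refine ((AddLocalization.addMonoidOf (⊤ : AddSubmonoid (V D))).eq_iff_exists).trans ?_
  simp only [Subtype.exists, AddSubmonoid.mem_top, exists_const, add_comm]

end Grothendieck

/-! ### The relations governing `K_0` and `K_1` -/

section Relations

/-- The matrix whose entries are the components of a tuple. -/
abbrev tupleMatrix {R : Type*} {ι κ τ : Type*} (e : κ × ι → τ) (x : τ → R) : Matrix κ ι R :=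
  Matrix.of fun i j => x (e (i, j))

lemma continuous_tupleMatrix {R : Type*} [TopologicalSpace R] {ι κ τ : Type*} (e : κ × ι → τ) :
    Continuous (tupleMatrix e : (τ → R) → Matrix κ ι R) :=
  continuous_matrix fun _ _ => continuous_apply _

variable (N : Type*) [NonUnitalCStarAlgebra N]

/-- The relation "`a ⊕ r ∼ b ⊕ p ⊕ r` for a projection `p` over `N` and a projection `r` over
`N⁺`" between projections `a` and `b` over `N⁺`. -/
def stableRel (m n j l : ℕ) : TupleRel (Unitization ℂ N) where
  In := (Fin m × Fin m) ⊕ (Fin n × Fin n)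
  Out := (Fin j × Fin j) ⊕ (Fin l × Fin l) ⊕ (Fin (n + j + l) × Fin (m + l))
  Holds x y :=
    let a := tupleMatrix Sum.inl x
    let b := tupleMatrix Sum.inr x
    let p := tupleMatrix Sum.inl y
    let r := tupleMatrix (Sum.inr ∘ Sum.inl) y
    let v := tupleMatrix (Sum.inr ∘ Sum.inr) y
    (IsStarProjection a ∧ IsStarProjection b ∧ IsStarProjection p ∧ IsStarProjection r) ∧
      -- All tuples take values in `N⁺`; vanishing scalar parts are what place `p` over `N`.
      (∀ i, (y (Sum.inl i)).fst = 0) ∧ vᴴ * v = dsum a r ∧ v * vᴴ = dsum (dsum b p) r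

/-- The relation "`u` is the product of the exponentials of `k` skew-adjoint matrices". -/
def expRel (n k : ℕ) : TupleRel (Unitization ℂ N) where
  In := Fin n × Fin n
  Out := Fin k × (Fin n × Fin n)
  Holds x y :=
    tupleMatrix id x ∈ unitary (Matrix (Fin n) (Fin n) (Unitization ℂ N)) ∧
      (∀ i, IsSelfAdjoint (tupleMatrix (Prod.mk i) y)) ∧
      (List.ofFn fun i => NormedSpace.exp (Complex.I • tupleMatrix (Prod.mk i) y)).prod =
        tupleMatrix id x

variable {N} {B : NonUnitalStarSubalgebra ℂ N} [IsClosed (B : Set N)]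

lemma unitizationIncl_map_injective {ι κ : Type*} :
    Function.Injective fun M : Matrix ι κ (Unitization ℂ B) => M.map (unitizationIncl B) :=
  Matrix.map_injective (unitizationIncl_injective B)

/-- The conditions are `*`-algebraic identities and the vanishing of scalar parts; the injective map
`B⁺ → N⁺` reflects both. -/
lemma stableRel_of_map {m n j l : ℕ} {x : (stableRel B m n j l).In → Unitization ℂ B}
    {y : (stableRel B m n j l).Out → Unitization ℂ B}
    (h : (stableRel N m n j l).Holds (unitizationIncl B ∘ x) (unitizationIncl B ∘ y)) :
    (stableRel B m n j l).Holds x y := by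
  obtain ⟨⟨h1, h2, h3, h4⟩, h5, h6, h7⟩ := h
  have hf : Function.Injective (unitizationIncl B).toNonUnitalStarAlgHom :=
    unitizationIncl_injective B
  refine ⟨⟨isStarProjection_of_map_injective hf h1, isStarProjection_of_map_injective hf h2,
    isStarProjection_of_map_injective hf h3, isStarProjection_of_map_injective hf h4⟩, fun i => ?_, ?_, ?_⟩
  · have : (unitizationIncl B (y (Sum.inl i))).fst = 0 := h5 i
    rw [unitizationIncl_apply] at this
    simpa using this
  · apply Matrix.map_injective hf
    dsimp only
    rw [map_mul_matrix, map_conjTranspose_matrix, map_dsum]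
    exact h6
  · apply Matrix.map_injective hf
    dsimp only
    rw [map_mul_matrix, map_conjTranspose_matrix, map_dsum, map_dsum]
    exact h7

/-- Beyond `*`-algebraic identities only the exponential occurs, and it commutes with the entrywise
inclusion. -/
lemma expRel_of_map {n k : ℕ} {x : (expRel B n k).In → Unitization ℂ B}
    {y : (expRel B n k).Out → Unitization ℂ B}
    (h : (expRel N n k).Holds (unitizationIncl B ∘ x) (unitizationIncl B ∘ y)) :
    (expRel B n k).Holds x y := by
  obtain ⟨h1, h2, h3⟩ := h
  let φ : Matrix (Fin n) (Fin n) (Unitization ℂ B) →+* Matrix (Fin n) (Fin n) (Unitization ℂ N) :=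
    RingHom.mapMatrix (unitizationIncl B : Unitization ℂ B →+* Unitization ℂ N)
  have hφ : Function.Injective φ := unitizationIncl_map_injective
  have hstar : ∀ M, φ (star M) = star (φ M) := fun M =>
    map_conjTranspose_matrix (unitizationIncl B).toNonUnitalStarAlgHom M
  have hexp : ∀ M, φ (NormedSpace.exp M) = NormedSpace.exp (φ M) :=
    map_exp_matrix (unitizationIncl B)
  have hsmul : ∀ M, φ (Complex.I • M) = Complex.I • φ M := fun M => by
    refine Matrix.ext fun i j => ?_
    exact map_smul (unitizationIncl B) _ _
  refine ⟨?_, fun i => hφ ((hstar _).trans (h2 i)), hφ ?_⟩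
  · rw [Unitary.mem_iff] at h1 ⊢
    refine ⟨hφ ?_, hφ ?_⟩ <;> rw [map_mul, hstar, map_one]
    exacts [h1.1, h1.2]
  · rw [map_list_prod, List.map_ofFn]
    simp only [Function.comp_def, hexp, hsmul]
    exact h3

end Relations

/-! ### K-theory of saturated subalgebras -/

section Saturated

variable {N : Type*} [NonUnitalCStarAlgebra N]

/-- Inputs in `B⁺` of the relation `R` with witnesses in `N⁺` can be approximated by inputs in
`B⁺` with witnesses in `B⁺`. -/
def Saturated (B : NonUnitalStarSubalgebra ℂ N) [IsClosed (B : Set N)]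
    (R : TupleRel (Unitization ℂ N)) : Prop :=
  ∀ (x : R.In → Unitization ℂ B) y, R.Holds (unitizationIncl B ∘ x) y →
    ∀ W ∈ nhds x, ∃ x' ∈ W, ∃ y' : R.Out → Unitization ℂ B,
      R.Holds (unitizationIncl B ∘ x') (unitizationIncl B ∘ y')

variable {B : NonUnitalStarSubalgebra ℂ N} [IsClosed (B : Set N)]

/-- Saturation replaces `a` and `b` by nearby projections over `B⁺`, which have the same classes,
and supplies new witnesses over `B⁺`. The new `q` need not be close to `p`; only its size `j` is
retained. -/
lemma exists_stable_eq_of_saturated (hB : ∀ m n j l, Saturated B (stableRel N m n j l))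
    (a b : V (Unitization ℂ B)) {j : ℕ} {p : Matrix (Fin j) (Fin j) N} (hp : IsStarProjection p)
    (r : V (Unitization ℂ N))
    (h : V.map (unitizationIncl B).toNonUnitalStarAlgHom a + r =
      V.map (unitizationIncl B).toNonUnitalStarAlgHom b +
        V.map (Unitization.inrNonUnitalStarAlgHom ℂ N) (V.mk p hp) + r) :
    ∃ (q : Matrix (Fin j) (Fin j) B) (hq : IsStarProjection q) (s : V (Unitization ℂ B)),
      a + s = b + V.map (Unitization.inrNonUnitalStarAlgHom ℂ B) (V.mk q hq) + s := by
  induction a using V.ind with | _ m a ha => ?_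
  induction b using V.ind with | _ n b hb => ?_
  induction r using V.ind with | _ l r hr => ?_
  obtain ⟨v, hv1, hv2⟩ := V.mk_eq_iff.1 h
  let x : (stableRel N m n j l).In → Unitization ℂ B :=
    Sum.elim (fun i => a i.1 i.2) (fun i => b i.1 i.2)
  let y : (stableRel N m n j l).Out → Unitization ℂ N :=
    Sum.elim (fun i => (p i.1 i.2 : Unitization ℂ N))
      (Sum.elim (fun i => r i.1 i.2) (fun i => v i.1 i.2))
  obtain ⟨Wa, hWa, ha'⟩ := exists_nhds_mvN ha
  obtain ⟨Wb, hWb, hb'⟩ := exists_nhds_mvN hb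
  have hW : tupleMatrix Sum.inl ⁻¹' Wa ∩ tupleMatrix Sum.inr ⁻¹' Wb ∈ nhds x :=
    Filter.inter_mem ((continuous_tupleMatrix _).continuousAt.preimage_mem_nhds hWa)
      ((continuous_tupleMatrix _).continuousAt.preimage_mem_nhds hWb)
  obtain ⟨x', ⟨hxa, hxb⟩, y', hxy⟩ := hB m n j l x y
    ⟨⟨isStarProjection_map (unitizationIncl B).toNonUnitalStarAlgHom ha,
      isStarProjection_map (unitizationIncl B).toNonUnitalStarAlgHom hb,
      isStarProjection_map (Unitization.inrNonUnitalStarAlgHom ℂ N) hp, hr⟩,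
      fun _ => rfl, hv1, hv2⟩ _ hW
  obtain ⟨⟨h1, h2, h3, h4⟩, h5, h6, h7⟩ := stableRel_of_map hxy
  -- The witness for `p` has zero scalar parts, so it is the image of its matrix of `B`-components.
  let q : Matrix (Fin j) (Fin j) B := Matrix.of fun i i' => (y' (Sum.inl (i, i'))).snd
  have hqy : q.map (Unitization.inrNonUnitalStarAlgHom ℂ B) = tupleMatrix Sum.inl y' := by
    ext i i'
    · exact (h5 (i, i')).symm
    · rfl
  have hq : IsStarProjection q :=
    isStarProjection_of_map_injective (f := Unitization.inrNonUnitalStarAlgHom ℂ B)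
      Unitization.inr_injective (by rw [hqy]; exact h3)
  refine ⟨q, hq, V.mk _ h4, ?_⟩
  have e1 : V.mk a ha = V.mk _ h1 := V.mk_eq_iff.2 (ha' _ hxa h1)
  have e2 : V.mk b hb = V.mk _ h2 := V.mk_eq_iff.2 (hb' _ hxb h2)
  have e3 : V.map (Unitization.inrNonUnitalStarAlgHom ℂ B) (V.mk q hq) = V.mk _ h3 := by
    rw [V.map_mk]
    congr 1
  rw [e1, e2, e3]
  exact V.mk_eq_iff.2 ⟨_, h6, h7⟩

lemma K0.exists_eq_ofV_of_saturated (hB : ∀ m n j l, Saturated B (stableRel N m n j l))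
    (z : K0 B) {j : ℕ} {p : Matrix (Fin j) (Fin j) N} (hp : IsStarProjection p)
    (h : K0.map (NonUnitalStarSubalgebraClass.subtype B) z = K0.ofV N (V.mk p hp)) :
    ∃ (q : Matrix (Fin j) (Fin j) B) (hq : IsStarProjection q), z = K0.ofV B (V.mk q hq) := by
  obtain ⟨z, hz⟩ := z
  obtain ⟨a, b, rfl⟩ := K00.exists_eq_sub z
  have h' : K00.map (unitizationIncl B).toNonUnitalStarAlgHom
      (Algebra.GrothendieckAddGroup.of a - Algebra.GrothendieckAddGroup.of b) =
      Algebra.GrothendieckAddGroup.of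
        (V.map (Unitization.inrNonUnitalStarAlgHom ℂ N) (V.mk p hp)) := congrArg Subtype.val h
  rw [map_sub, K00.map_of, K00.map_of, sub_eq_iff_eq_add', ← map_add, K00.of_eq_of_iff] at h'
  obtain ⟨r, hr⟩ := h'
  obtain ⟨q, hq, s, hs⟩ := exists_stable_eq_of_saturated hB a b hp r hr
  refine ⟨q, hq, Subtype.ext ?_⟩
  change _ = Algebra.GrothendieckAddGroup.of
    (V.map (Unitization.inrNonUnitalStarAlgHom ℂ B) (V.mk q hq))
  rw [sub_eq_iff_eq_add', ← map_add, K00.of_eq_of_iff]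
  exact ⟨s, hs⟩

lemma K0.map_ofV {C D : Type*} [NonUnitalCStarAlgebra C] [NonUnitalCStarAlgebra D]
    (f : C →⋆ₙₐ[ℂ] D) (x : V C) : K0.map f (K0.ofV C x) = K0.ofV D (V.map f x) := by
  refine Subtype.ext ?_
  change K00.map (unitizationMap f).toNonUnitalStarAlgHom (Algebra.GrothendieckAddGroup.of
    (V.map (Unitization.inrNonUnitalStarAlgHom ℂ C) x)) = Algebra.GrothendieckAddGroup.of
    (V.map (Unitization.inrNonUnitalStarAlgHom ℂ D) (V.map f x))
  rw [K00.map_of, V.map_map, V.map_map]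
  have h : (unitizationMap f).toNonUnitalStarAlgHom.comp
      (Unitization.inrNonUnitalStarAlgHom ℂ C) =
      (Unitization.inrNonUnitalStarAlgHom ℂ D).comp f :=
    NonUnitalStarAlgHom.ext fun c => Unitization.starMap_inr f c
  rw [h]

lemma K0.map_injective_of_saturated (hB : ∀ m n j l, Saturated B (stableRel N m n j l)) :
    Function.Injective (K0.map (NonUnitalStarSubalgebraClass.subtype B)) := by
  rw [injective_iff_map_eq_zero]
  intro z hz
  have h0 : K0.ofV N (V.mk (0 : Matrix (Fin 0) (Fin 0) N) (.zero _)) = 0 := by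
    rw [V.mk_zero, map_zero]
  obtain ⟨q, hq, rfl⟩ := K0.exists_eq_ofV_of_saturated hB z (.zero _) (hz.trans h0.symm)
  -- Keeping the size of the projection pays off here: `q` is a `0 × 0` matrix.
  obtain rfl : q = 0 := Subsingleton.elim _ _
  rw [V.mk_zero, map_zero]

lemma K0.map_mem_positive_iff_of_saturated
    (hB : ∀ m n j l, Saturated B (stableRel N m n j l)) (z : K0 B) :
    K0.map (NonUnitalStarSubalgebraClass.subtype B) z ∈ K0.positive N ↔ z ∈ K0.positive B := by
  constructor
  · rintro ⟨x, hx⟩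
    induction x using V.ind with | _ j p hp => ?_
    obtain ⟨q, hq, rfl⟩ := K0.exists_eq_ofV_of_saturated hB z hp hx.symm
    exact ⟨_, rfl⟩
  · rintro ⟨x, rfl⟩
    exact ⟨_, (K0.map_ofV _ x).symm⟩

/-- Near `u` there is a unitary over `B⁺` that is a product of exponentials over `B⁺`. It is joined
to `1` by that factorization and to `u` by proximity. -/
lemma U.joined_one_of_saturated (hB : ∀ n k, Saturated B (expRel N n k)) {n : ℕ}
    (u : U n (Unitization ℂ B)) (hu : Joined 1 (U.map n (unitizationIncl B) u)) :
    Joined 1 u := by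
  obtain ⟨k, y, hy, hyu⟩ := U.joined_one_iff.1 hu
  obtain ⟨W, hW, hWu⟩ := U.exists_nhds_joined u
  let x : (expRel N n k).In → Unitization ℂ B := fun i => u.1 i.1 i.2
  obtain ⟨x', hx', y', hxy⟩ := hB n k x (fun t => y t.1 t.2.1 t.2.2)
    ⟨(U.map n (unitizationIncl B) u).2, hy, hyu⟩ (tupleMatrix id ⁻¹' W)
    ((continuous_tupleMatrix _).continuousAt.preimage_mem_nhds hW)
  obtain ⟨h1, h2, h3⟩ := expRel_of_map hxy
  exact (U.joined_one_iff (u := ⟨_, h1⟩).2 ⟨k, _, h2, h3⟩).trans (hWu ⟨_, h1⟩ hx').symm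

lemma K1.map_injective_of_saturated (hB : ∀ n k, Saturated B (expRel N n k)) :
    Function.Injective (K1.map (NonUnitalStarSubalgebraClass.subtype B)) := by
  rw [injective_iff_map_eq_one]
  intro x hx
  obtain ⟨n, x, rfl⟩ := DirectLimit.exists_eq_mk (padPiZero (Unitization ℂ B)) x
  have hx' : (⟦⟨n, PiZeroU.map n (unitizationIncl B) x⟩⟧ :
      DirectLimit _ (padPiZero (Unitization ℂ N))) = 1 := hx
  -- A class trivial in the limit is trivial at some finite size `m`; padding commutes with the
  -- inclusion, so the question is about one unitary of size `m` over `B⁺`.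
  obtain ⟨m, hnm, h⟩ := DirectLimit.exists_eq_one (f := padPiZero (Unitization ℂ N)) _ |>.1 hx'
  rw [PiZeroU.map_pad] at h
  refine (DirectLimit.exists_eq_one (f := padPiZero (Unitization ℂ B)) _).2 ⟨m, hnm, ?_⟩
  change padPiZero _ n m hnm x = 1
  obtain ⟨u, hu⟩ := QuotientGroup.mk_surjective (padPiZero (Unitization ℂ B) n m hnm x)
  rw [← hu] at h ⊢
  exact (QuotientGroup.eq_one_iff _).2
    (U.joined_one_of_saturated hB u ((QuotientGroup.eq_one_iff _).1 h))

end Saturated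

end CStarKTheory

end

theorem lemma1p5 {N : Type*} [NonUnitalCStarAlgebra N] (A : NonUnitalStarSubalgebra ℂ N)
    (hA : IsClosed (A : Set N)) (hAs : TopologicalSpace.IsSeparable (A : Set N)) :
    ∃ (B : NonUnitalStarSubalgebra ℂ N) (_ : IsClosed (B : Set N)),
      TopologicalSpace.IsSeparable (B : Set N) ∧ A ≤ B ∧
      Function.Injective (CStarKTheory.K0.map (NonUnitalStarSubalgebraClass.subtype B)) ∧
      Function.Injective (CStarKTheory.K1.map (NonUnitalStarSubalgebraClass.subtype B)) ∧
      ∀ x y : CStarKTheory.K0 B,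
        CStarKTheory.K0.map (NonUnitalStarSubalgebraClass.subtype B) x ≤
            CStarKTheory.K0.map (NonUnitalStarSubalgebraClass.subtype B) y ↔ x ≤ y := by
  obtain ⟨B, hB, hBs, hAB, h⟩ := CStarKTheory.exists_separable_saturated
    (Sum.elim (fun t : ℕ × ℕ × ℕ × ℕ => CStarKTheory.stableRel N t.1 t.2.1 t.2.2.1 t.2.2.2)
      (fun t : ℕ × ℕ => CStarKTheory.expRel N t.1 t.2)) A hAs
  have h0 : ∀ m n j l, CStarKTheory.Saturated B (CStarKTheory.stableRel N m n j l) :=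
    fun m n j l => h (Sum.inl (m, n, j, l))
  have h1 : ∀ n k, CStarKTheory.Saturated B (CStarKTheory.expRel N n k) :=
    fun n k => h (Sum.inr (n, k))
  refine ⟨B, hB, hBs, hAB, CStarKTheory.K0.map_injective_of_saturated h0,
    CStarKTheory.K1.map_injective_of_saturated h1, fun x y => ?_⟩
  -- Both inequalities say that a difference lies in the positive cone, so the order statement is
  -- the cone statement for `y - x`.
  refine Iff.trans ?_ (CStarKTheory.K0.map_mem_positive_iff_of_saturated h0 (y - x))
  rw [map_sub]
  rfl
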